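/- Let $\mathbb{S}^2\subset\mathbb{R}^3$ be the unit sphere, $x_0=(0,0,-1)$ the South Pole, and let $\Omega$ be the group of orientation-preserving $C^\infty$ diffeomorphisms of $\mathbb{S}^2$. Put $$\Omega_1:=\{f\in\Omega : f(x_0)=x_0 \text{ and } df|_{x_0}=\mathrm{id}_{T_{x_0}\mathbb{S}^2}\}.$$ Equip $\Omega_1$ with the standard functional diffeology: for $U$ open in some $\mathbb{R}^n$, a map $P:U\to\Omega_1$ is a plot if $U\times\mathbb{S}^2\to\mathbb{S}^2$, $(s,x)\mapsto P(s)(x)$, is $C^\infty$. A function $\varepsilon$ on $\Omega_1$ with values in a subset of $\mathbb{R}$ is called diffeologically smooth if $\varepsilon\circ P$ is $C^\infty$ for every plot $P$ of $\Omega_1$. Let $p:\mathbb{S}^2\smallsetminus\{-x_0\}\to\mathbb{R}^2$, $p(x_1,x_2,x_3)=\left(\frac{2x_1}{1-x_3},\frac{2x_2}{1-x_3}\right)$, be the stereographic projection from the North Pole, and for $f\in\Omega_1$ let $\bar f:=p\circ f\circ p^{-1}$, which is defined at those $y\in\mathbb{R}^2$ with $f(p^{-1}(y))\neq -x_0$.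 Let $B(r)\subset\mathbb{R}^2$ be the open Euclidean ball of radius $r$ around $0$. Then there exists a diffeologically smooth function $\varepsilon:\Omega_1\to(0,\tfrac12]$ such that for every $f\in\Omega_1$: 1. $\bar f$ is defined on all of $B(2\varepsilon(f))$; 2. $\|d\bar f|_y-\mathrm{id}\|<\tfrac14$ for all $y\in B(\varepsilon(f))$, where $\|\cdot\|$ is the operator norm induced by the Euclidean norm on $\mathbb{R}^2$. -/

import Mathlib

open scoped Manifold ContDiff

noncomputable section

namespace SphereDiff

/-- Euclidean `ℝ²`. -/
abbrev E2 : Type := EuclideanSpace ℝ (Fin 2)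

/-- Euclidean `ℝ³`. -/
abbrev E3 : Type := EuclideanSpace ℝ (Fin 3)

/-- The unit sphere `𝕊²` in `ℝ³`, with Mathlib's smooth manifold structure. -/
abbrev S2 : Type := Metric.sphere (0 : E3) 1

/-- The North Pole `(0, 0, 1)`. -/
def northPole : S2 :=
  ⟨!₂[0, 0, 1], by simp [EuclideanSpace.norm_eq, Fin.sum_univ_three]⟩

/-- The South Pole `x₀ = (0, 0, -1)`. -/
def southPole : S2 := -northPole

/-! ### Functional diffeology -/

section Diffeology

variable {EX HX X EY HY Y : Type*}
  [NormedAddCommGroup EX] [NormedSpace ℝ EX] [TopologicalSpace HX]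
  (I : ModelWithCorners ℝ EX HX) [TopologicalSpace X] [ChartedSpace HX X]
  [NormedAddCommGroup EY] [NormedSpace ℝ EY] [TopologicalSpace HY]
  (J : ModelWithCorners ℝ EY HY) [TopologicalSpace Y] [ChartedSpace HY Y]

/-- The standard functional diffeology on a family `Λ` of smooth maps `X → Y`, given through its
evaluation `ev`: for `U` open in `ℝⁿ`, a map `P : U → Λ` is a plot iff
`U × X → Y, (s, x) ↦ ev (P s) x` is smooth. -/
@[reducible]
def functionalDiffeology {Λ : Type*} (ev : Λ → X → Y) (hev : ∀ l, ContMDiff I J ∞ (ev l)) :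
    DiffeologicalSpace Λ :=
  DiffeologicalSpace.ofCorePlotsOn
    { isPlotOn := fun {n U} _ P =>
        ContMDiffOn ((𝓡 n).prod I) J ∞
          (fun q : EuclideanSpace ℝ (Fin n) × X => ev (P q.1) q.2) (U ×ˢ Set.univ)
      isPlotOn_congr := fun _ _ _ h =>
        contMDiffOn_congr fun q hq => by simp only [h hq.1]
      isPlot_const := fun l => ((hev l).comp contMDiff_snd).contMDiffOn
      isPlotOn_reparam := fun {n m U V} _ _ P g h hP hg => by
        have hpair : ContMDiffOn ((𝓡 m).prod I) ((𝓡 n).prod I) ∞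
            (fun q : EuclideanSpace ℝ (Fin m) × X => (g q.1, q.2)) (V ×ˢ Set.univ) :=
          (hg.contMDiffOn.comp contMDiffOn_fst fun q hq => hq.1).prodMk contMDiffOn_snd
        exact hP.comp hpair fun q hq => ⟨h hq.1, trivial⟩
      locality := fun {n U} _ P hP q hq => by
        obtain ⟨V, hV, hqV, hPV⟩ := hP q.1 hq.1
        exact (hPV.contMDiffAt ((hV.prod isOpen_univ).mem_nhds ⟨hqV, trivial⟩)).contMDiffWithinAt }

end Diffeology

/-! ### The diffeomorphism groups -/

/-- `C^∞` diffeomorphisms of `𝕊²`. -/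
abbrev DiffS2 : Type := S2 ≃ₘ^∞⟮𝓡 2, 𝓡 2⟯ S2

/-- The inclusion `T_x 𝕊² → ℝ³`, i.e. the differential at `x` of the inclusion `𝕊² → ℝ³`. -/
def tangentIncl (x : S2) : TangentSpace (𝓡 2) x →L[ℝ] E3 :=
  mfderiv (𝓡 2) 𝓘(ℝ, E3) (fun z : S2 => (z : E3)) x

/-- The determinant of three vectors of `ℝ³`. -/
def det3 (a b c : E3) : ℝ := Matrix.det (Matrix.of ![a.ofLp, b.ofLp, c.ofLp])

/-- A basis `(v, w)` of `T_x 𝕊²` is positively oriented when `(x, v, w)` is positively oriented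
in `ℝ³` (orientation by the outward normal). A diffeomorphism preserves the orientation when it
maps positively oriented bases to positively oriented bases, at every point. -/
def OrientationPreserving (f : DiffS2) : Prop :=
  ∀ (x : S2) (v w : TangentSpace (𝓡 2) x),
    0 < det3 (x : E3) (tangentIncl x v) (tangentIncl x w) →
    0 < det3 (f x : E3) (tangentIncl (f x) (mfderiv (𝓡 2) (𝓡 2) f x v))
      (tangentIncl (f x) (mfderiv (𝓡 2) (𝓡 2) f x w))

/-- `Ω`: the orientation-preserving `C^∞` diffeomorphisms of `𝕊²`. -/
def Omega : Set DiffS2 := {f | OrientationPreserving f}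

/-- `Ω₁ = {f ∈ Ω : f(x₀) = x₀ and df|_{x₀} = id}`. Tangent vectors are compared in `ℝ³`. -/
def Omega1 : Set DiffS2 :=
  {f | f ∈ Omega ∧ f southPole = southPole ∧
    ∀ v : TangentSpace (𝓡 2) southPole,
      tangentIncl (f southPole) (mfderiv (𝓡 2) (𝓡 2) f southPole v) = tangentIncl southPole v}

/-- `Ω₁` carries the standard functional diffeology. -/
instance : DiffeologicalSpace Omega1 :=
  functionalDiffeology (𝓡 2) (𝓡 2) (fun (f : Omega1) (x : S2) => f.1 x) fun f => f.1.contMDiff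

/-! ### Stereographic coordinates -/

lemma sq_sum (x : S2) : (x : E3) 0 ^ 2 + (x : E3) 1 ^ 2 + (x : E3) 2 ^ 2 = 1 := by
  have h := EuclideanSpace.norm_sq_eq (x : E3)
  rw [norm_eq_of_mem_sphere x] at h
  simp [Fin.sum_univ_three] at h
  linarith

lemma one_sub_ne_zero {x : S2} (hx : x ≠ northPole) : 1 - (x : E3) 2 ≠ 0 := by
  intro h
  have h2 : (x : E3) 2 = 1 := by linarith
  have hs := sq_sum x
  rw [h2] at hs
  have h0 : (x : E3) 0 = 0 := by nlinarith [sq_nonneg ((x : E3) 0), sq_nonneg ((x : E3) 1)]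
  have h1 : (x : E3) 1 = 0 := by nlinarith [sq_nonneg ((x : E3) 0), sq_nonneg ((x : E3) 1)]
  apply hx
  ext i
  fin_cases i <;> simp [northPole, h0, h1, h2]

/-- The stereographic projection `p : 𝕊² ∖ {N} → ℝ²` from the North Pole `N`,
`p(x₁, x₂, x₃) = (2x₁/(1 - x₃), 2x₂/(1 - x₃))`, with its inverse. -/
def stereo : PartialEquiv S2 E2 where
  toFun x := !₂[2 * (x : E3) 0 / (1 - (x : E3) 2), 2 * (x : E3) 1 / (1 - (x : E3) 2)]
  invFun y := ⟨!₂[4 * y 0 / (y 0 ^ 2 + y 1 ^ 2 + 4), 4 * y 1 / (y 0 ^ 2 + y 1 ^ 2 + 4),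
      (y 0 ^ 2 + y 1 ^ 2 - 4) / (y 0 ^ 2 + y 1 ^ 2 + 4)], by
    have h : y 0 ^ 2 + y 1 ^ 2 + 4 ≠ 0 := by positivity
    rw [mem_sphere_zero_iff_norm, EuclideanSpace.norm_eq, Real.sqrt_eq_one]
    simp only [Fin.sum_univ_three, Real.norm_eq_abs, sq_abs]
    simp
    field_simp
    ring⟩
  source := {northPole}ᶜ
  target := Set.univ
  map_source' _ _ := trivial
  map_target' y _ := by
    have h : y 0 ^ 2 + y 1 ^ 2 + 4 ≠ 0 := by positivity
    intro hy
    have h2 := congrArg (fun z : S2 => (z : E3) 2) hy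
    simp [northPole] at h2
    rw [div_eq_one_iff_eq h] at h2
    linarith
  left_inv' x hx := by
    have h := one_sub_ne_zero hx
    have hs := sq_sum x
    set a := (x : E3) 0 with ha
    set b := (x : E3) 1 with hb
    set c := (x : E3) 2 with hc
    have hq : (2 * a / (1 - c)) ^ 2 + (2 * b / (1 - c)) ^ 2 = 4 * (1 + c) / (1 - c) := by
      field_simp
      linear_combination 4 * hs
    have hd : 4 * (1 + c) / (1 - c) + 4 = 8 / (1 - c) := by
      field_simp
      ring
    ext i
    fin_cases i
    · simp [hq, hd, ← ha]
      field_simp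
      ring
    · simp [hq, hd, ← hb]
      field_simp
      ring
    · simp [hq, hd, ← hc]
      field_simp
      ring
  right_inv' y _ := by
    have h : y 0 ^ 2 + y 1 ^ 2 + 4 ≠ 0 := by positivity
    have hd : 1 - (y 0 ^ 2 + y 1 ^ 2 - 4) / (y 0 ^ 2 + y 1 ^ 2 + 4)
        = 8 / (y 0 ^ 2 + y 1 ^ 2 + 4) := by
      field_simp
      ring
    ext i
    fin_cases i
    · simp [hd]
      field_simp
      ring
    · simp [hd]
      field_simp
      ring

/-- The set of `y ∈ ℝ²` at which the local expression `p ∘ f ∘ p⁻¹` is defined, i.e. at which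
`f (p⁻¹ y)` lies in the domain of `p`. -/
def localExprDomain (f : DiffS2) : Set E2 := {y | f (stereo.symm y) ∈ stereo.source}

/-- The local expression `f̄ = p ∘ f ∘ p⁻¹`; meaningful on `localExprDomain f`. -/
def localExpr (f : DiffS2) (y : E2) : E2 := stereo (f (stereo.symm y))

end SphereDiff

end

/-! The local expression is only partially defined, so the estimates are made for $F = f\circ
p^{-1}:\mathbb{R}^2\to\mathbb{R}^3$ (`planeMap`), which is smooth everywhere. The conditions at
$x_0$ say $F(0)=(0,0,-1)$ and $dF_0$ = the horizontal inclusion (`fderiv_planeMap_zero`). If $M\ge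
1$ bounds $\|d^2F\|$ on the unit disc, Taylor estimates make $\varepsilon = 1/(20M)$ work
(`norm_fderiv_stereoComp_sub_id_lt`). A supremum need not depend smoothly on $f$, so $M$ is a smooth
majorant instead: the norm is replaced by a smooth function above it, and the supremum over a square
by iterated integrals (`supBound₂`). Differentiation under the integral sign then makes $M$, hence
$\varepsilon$, smooth along plots. -/

noncomputable section

namespace SphereDiff

/-! ### Smooth dependence of integrals on parameters. -/

section ParametricIntegral

open MeasureTheory Topology

universe u

variable {E F : Type u} [NormedAddCommGroup E] [NormedSpace ℝ E] [FiniteDimensional ℝ E]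
  [NormedAddCommGroup F] [NormedSpace ℝ F]

lemma hasFDerivAt_intervalIntegral_param [CompleteSpace F] {g : E → ℝ → F}
    (hg : ContDiff ℝ 1 (Function.uncurry g)) (a b : ℝ) (x₀ : E) :
    HasFDerivAt (fun x => ∫ t in a..b, g x t)
      (∫ t in a..b, fderiv ℝ (fun x => g x t) x₀) x₀ := by
  have hd : Continuous (Function.uncurry fun (x : E) (t : ℝ) => fderiv ℝ (fun x => g x t) x) := by
    have h : ContDiff ℝ 1 (Function.uncurry fun (p : E × ℝ) (x : E) => g x p.2) :=
      hg.comp (contDiff_snd.prodMk (contDiff_snd.comp contDiff_fst))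
    exact (h.fderiv (n := 0) contDiff_fst (by simp)).continuous
  have : ProperSpace E := FiniteDimensional.proper ℝ E
  obtain ⟨C, hC⟩ := ((isCompact_closedBall x₀ 1).prod isCompact_uIcc).exists_bound_of_continuousOn
    (f := Function.uncurry fun (x : E) (t : ℝ) => fderiv ℝ (fun x => g x t) x)
    (s := Metric.closedBall x₀ 1 ×ˢ Set.uIcc a b) hd.continuousOn
  have hgc : ∀ x, Continuous (g x) := fun x =>
    hg.continuous.comp (by fun_prop : Continuous fun t : ℝ => (x, t))
  refine intervalIntegral.hasFDerivAt_integral_of_dominated_of_fderiv_le (bound := fun _ => C)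
    (F' := fun x t => fderiv ℝ (fun x => g x t) x)
    (Metric.ball_mem_nhds x₀ one_pos)
    (Filter.Eventually.of_forall fun x => (hgc x).aestronglyMeasurable)
    ((hgc x₀).intervalIntegrable a b)
    (Continuous.aestronglyMeasurable (hd.comp (by fun_prop : Continuous fun t : ℝ => (x₀, t))))
    ?_ intervalIntegrable_const ?_
  · refine Filter.Eventually.of_forall fun t ht x hx => ?_
    exact hC (x, t) ⟨Metric.ball_subset_closedBall hx, Set.uIoc_subset_uIcc ht⟩
  · refine Filter.Eventually.of_forall fun t ht x hx => ?_
    have : DifferentiableAt ℝ (fun x => g x t) x :=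
      ((hg.comp (contDiff_id.prodMk contDiff_const)).differentiable one_ne_zero) x
    exact this.hasFDerivAt

omit [FiniteDimensional ℝ E] in
lemma contDiff_partial_fderiv {g : E → ℝ → F} {m n : ℕ∞ω}
    (hg : ContDiff ℝ n (Function.uncurry g)) (hmn : m + 1 ≤ n) :
    ContDiff ℝ m (Function.uncurry fun (x : E) (t : ℝ) => fderiv ℝ (fun x => g x t) x) := by
  have h : ContDiff ℝ n (Function.uncurry fun (p : E × ℝ) (x : E) => g x p.2) :=
    hg.comp (contDiff_snd.prodMk (contDiff_snd.comp contDiff_fst))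
  exact h.fderiv contDiff_fst hmn

omit [FiniteDimensional ℝ E] in
lemma contDiff_partial_deriv {g : E → ℝ → F} (hg : ContDiff ℝ ∞ (Function.uncurry g)) :
    ContDiff ℝ ∞ (Function.uncurry fun (x : E) (t : ℝ) => deriv (g x) t) := by
  have h : ContDiff ℝ ∞ (Function.uncurry fun (p : E × ℝ) (t : ℝ) => g p.1 t) :=
    hg.comp ((contDiff_fst.comp contDiff_fst).prodMk contDiff_snd)
  have := (h.fderiv (n := ∞) contDiff_snd (by simp)).clm_apply (contDiff_const (c := (1 : ℝ)))
  exact this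

/-- The induction varies `F`, because the derivative of the integral is an integral with values in
`E →L[ℝ] F`; sharing one universe keeps that space in range. -/
lemma contDiff_nat_intervalIntegral_param (n : ℕ) : ∀ {F : Type u} [NormedAddCommGroup F]
    [NormedSpace ℝ F] [CompleteSpace F] {g : E → ℝ → F},
    ContDiff ℝ n (Function.uncurry g) → ∀ a b : ℝ, ContDiff ℝ n fun x => ∫ t in a..b, g x t := by
  induction n with
  | zero =>
    intro F _ _ _ g hg a b
    exact contDiff_zero.2
      (intervalIntegral.continuous_parametric_intervalIntegral_of_continuous' hg.continuous a b)
  | succ n ih =>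
    intro F _ _ _ g hg a b
    push_cast at hg ⊢
    refine contDiff_succ_iff_hasFDerivAt.2 ⟨_, ?_,
      fun x => hasFDerivAt_intervalIntegral_param (hg.of_le (by simp)) a b x⟩
    exact ih (contDiff_partial_fderiv hg le_rfl) a b

lemma contDiff_intervalIntegral_param [CompleteSpace F] {g : E → ℝ → F}
    (hg : ContDiff ℝ ∞ (Function.uncurry g)) (a b : ℝ) :
    ContDiff ℝ ∞ fun x => ∫ t in a..b, g x t :=
  contDiff_infty.2 fun n => contDiff_nat_intervalIntegral_param n (contDiff_infty.1 hg n) a b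

end ParametricIntegral

/-! ### Smooth majorants of suprema and norms. -/

section SupBound

/-- A bound for the supremum of `u` on `[-1, 1]` which depends smoothly on parameters. -/
def supBound (u : ℝ → ℝ) : ℝ := u 0 + ∫ t in (-1 : ℝ)..1, (1 + deriv u t ^ 2)

/-- Fundamental theorem of calculus from $0$ to $t$, with the nonsmooth $|u'|$ replaced by
$1+u'^2\ge|u'|$. -/
lemma le_supBound {u : ℝ → ℝ} (hu : ContDiff ℝ 1 u) {t : ℝ} (ht : |t| ≤ 1) :
    u t ≤ supBound u := by
  have hc : Continuous (deriv u) := hu.continuous_deriv le_rfl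
  have hd : Differentiable ℝ u := hu.differentiable one_ne_zero
  have hft : ∫ s in (0 : ℝ)..t, deriv u s = u t - u 0 :=
    intervalIntegral.integral_deriv_eq_sub (fun x _ => hd x) (hc.intervalIntegrable _ _)
  have hw : Continuous fun s => 1 + deriv u s ^ 2 := by fun_prop
  have habs : |u t - u 0| ≤ |∫ s in (0 : ℝ)..t, (1 + deriv u s ^ 2)| := by
    rw [← hft, ← Real.norm_eq_abs]
    refine intervalIntegral.norm_integral_le_abs_of_norm_le
      (Filter.Eventually.of_forall fun s => ?_) (hw.intervalIntegrable _ _)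
    rw [Real.norm_eq_abs, abs_le]
    constructor <;> nlinarith [sq_nonneg (deriv u s + 1), sq_nonneg (deriv u s - 1)]
  have hmono : |∫ s in (0 : ℝ)..t, (1 + deriv u s ^ 2)|
      ≤ |∫ s in (-1 : ℝ)..1, (1 + deriv u s ^ 2)| := by
    refine intervalIntegral.abs_integral_mono_interval ?_
      (Filter.Eventually.of_forall fun s => by positivity) (hw.intervalIntegrable _ _)
    have := abs_le.1 ht
    intro s hs
    rw [Set.mem_uIoc] at hs ⊢
    left
    rcases hs with hs | hs <;> constructor <;> linarith [hs.1, hs.2, this.1, this.2]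
  have hnn : 0 ≤ ∫ s in (-1 : ℝ)..1, (1 + deriv u s ^ 2) :=
    intervalIntegral.integral_nonneg (by norm_num) fun s _ => by positivity
  rw [abs_of_nonneg hnn] at hmono
  have := le_abs_self (u t - u 0)
  unfold supBound
  linarith

lemma contDiff_supBound {E : Type} [NormedAddCommGroup E] [NormedSpace ℝ E]
    [FiniteDimensional ℝ E] {g : E → ℝ → ℝ} (hg : ContDiff ℝ ∞ (Function.uncurry g)) :
    ContDiff ℝ ∞ fun x => supBound (g x) := by
  refine ContDiff.add (hg.comp (contDiff_id.prodMk contDiff_const)) ?_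
  exact contDiff_intervalIntegral_param
    (contDiff_const.add ((contDiff_partial_deriv hg).pow 2)) (-1) 1

/-- A bound for the supremum of `g` on the square `[-1, 1]²` which depends smoothly on
parameters. -/
def supBound₂ (g : E2 → ℝ) : ℝ := supBound fun a => supBound fun b => g !₂[a, b]

lemma contDiff_pair : ContDiff ℝ ∞ fun q : ℝ × ℝ => (!₂[q.1, q.2] : E2) := by
  rw [contDiff_euclidean]
  intro i
  fin_cases i
  · exact contDiff_fst
  · exact contDiff_snd

lemma contDiff_supBound₂ {E : Type} [NormedAddCommGroup E] [NormedSpace ℝ E]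
    [FiniteDimensional ℝ E] {g : E → E2 → ℝ} (hg : ContDiff ℝ ∞ (Function.uncurry g)) :
    ContDiff ℝ ∞ fun x => supBound₂ (g x) := by
  have h : ContDiff ℝ ∞ (Function.uncurry
      fun (p : E × ℝ) (b : ℝ) => g p.1 !₂[p.2, b]) :=
    hg.comp ((contDiff_fst.comp contDiff_fst).prodMk
      (contDiff_pair.comp ((contDiff_snd.comp contDiff_fst).prodMk contDiff_snd)))
  exact contDiff_supBound (contDiff_supBound h :
    ContDiff ℝ ∞ (Function.uncurry fun (x : E) (a : ℝ) => supBound fun b => g x !₂[a, b]))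

lemma le_supBound₂ {g : E2 → ℝ} (hg : ContDiff ℝ ∞ g) {y : E2} (hy : ‖y‖ ≤ 1) :
    g y ≤ supBound₂ g := by
  have h : ContDiff ℝ ∞ (Function.uncurry fun a b : ℝ => g !₂[a, b]) := hg.comp contDiff_pair
  have hy' : ∀ i, |y i| ≤ 1 := fun i => (PiLp.norm_apply_le y i).trans hy
  have hyy : y = !₂[y 0, y 1] := by ext i; fin_cases i <;> rfl
  have h1 : g !₂[y 0, y 1] ≤ supBound fun b => g !₂[y 0, b] :=
    le_supBound (u := fun b => g !₂[y 0, b])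
      ((h.comp (contDiff_const.prodMk contDiff_id)).of_le (by simp)) (hy' 1)
  have h2 := le_supBound (u := fun a => supBound fun b => g !₂[a, b])
    ((contDiff_supBound h).of_le (by simp)) (hy' 0)
  calc g y = g !₂[y 0, y 1] := by rw [← hyy]
    _ ≤ _ := h1.trans h2

/-- The norm of a finite-dimensional space has a smooth majorant. -/
lemma exists_contDiff_norm_le (V : Type*) [NormedAddCommGroup V] [NormedSpace ℝ V]
    [FiniteDimensional ℝ V] :
    ∃ q : V → ℝ, ContDiff ℝ ∞ q ∧ (∀ v, 1 ≤ q v) ∧ ∀ v, ‖v‖ ≤ q v := by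
  let e : V ≃L[ℝ] EuclideanSpace ℝ (Fin (Module.finrank ℝ V)) := toEuclidean
  let c := ‖(e.symm : EuclideanSpace ℝ (Fin (Module.finrank ℝ V)) →L[ℝ] V)‖
  -- The squared Euclidean norm is smooth, and $\|v\|\le c\|ev\|\le c^2+\|ev\|^2$. The summand $1$
  -- later yields $M\ge 1$.
  refine ⟨fun v => 1 + c ^ 2 + ‖e v‖ ^ 2, ?_, fun v => ?_, fun v => ?_⟩
  · exact contDiff_const.add (e.contDiff.norm_sq ℝ)
  · nlinarith [sq_nonneg c, sq_nonneg ‖e v‖]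
  · have h : ‖v‖ ≤ c * ‖e v‖ := by
      simpa using (e.symm : EuclideanSpace ℝ (Fin (Module.finrank ℝ V)) →L[ℝ] V).le_opNorm (e v)
    nlinarith [sq_nonneg (c - ‖e v‖), sq_nonneg c, sq_nonneg ‖e v‖]

end SupBound

/-! ### Stereographic coordinates and the 1-jet of $F$ at the origin. -/

section Stereographic

lemma contDiff_coe_stereo_symm : ContDiff ℝ ∞ fun y : E2 => (stereo.symm y : E3) := by
  have h0 : ContDiff ℝ ∞ fun y : E2 => y 0 := contDiff_euclidean.1 contDiff_id 0
  have h1 : ContDiff ℝ ∞ fun y : E2 => y 1 := contDiff_euclidean.1 contDiff_id 1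
  have hq : ∀ y : E2, y 0 ^ 2 + y 1 ^ 2 + 4 ≠ 0 := fun y => by positivity
  have hQ : ContDiff ℝ ∞ fun y : E2 => y 0 ^ 2 + y 1 ^ 2 + 4 :=
    ((h0.pow 2).add (h1.pow 2)).add contDiff_const
  rw [contDiff_euclidean]
  intro i
  fin_cases i
  · exact (contDiff_const.mul h0).div hQ hq
  · exact (contDiff_const.mul h1).div hQ hq
  · exact (((h0.pow 2).add (h1.pow 2)).sub contDiff_const).div hQ hq

lemma contMDiff_coe_S2 {m : ℕ∞ω} : ContMDiff (𝓡 2) 𝓘(ℝ, E3) m fun x : S2 => (x : E3) :=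
  haveI : Fact (Module.finrank ℝ E3 = 2 + 1) := ⟨finrank_euclideanSpace_fin⟩
  contMDiff_coe_sphere

lemma contMDiff_stereo_symm : ContMDiff 𝓘(ℝ, E2) (𝓡 2) ∞ fun y : E2 => stereo.symm y :=
  haveI : Fact (Module.finrank ℝ E3 = 2 + 1) := ⟨finrank_euclideanSpace_fin⟩
  ContMDiff.codRestrict_sphere (contDiff_coe_stereo_symm.contMDiff) _

/-- The inclusion `(a, b) ↦ (a, b, 0)`. -/
def horizontalIncl : E2 →L[ℝ] E3 :=
  LinearMap.toContinuousLinearMap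
    { toFun := fun y => !₂[y 0, y 1, 0]
      map_add' := fun x y => by ext i; fin_cases i <;> simp
      map_smul' := fun c y => by ext i; fin_cases i <;> simp }

/-- The projection `(a, b, c) ↦ (a, b)`. -/
def horizontalProj : E3 →L[ℝ] E2 :=
  LinearMap.toContinuousLinearMap
    { toFun := fun x => !₂[x 0, x 1]
      map_add' := fun x y => by ext i; fin_cases i <;> simp
      map_smul' := fun c y => by ext i; fin_cases i <;> simp }

/-- The height `(a, b, c) ↦ c`. -/
def height : E3 →L[ℝ] ℝ := EuclideanSpace.proj 2

lemma horizontalIncl_apply (y : E2) : horizontalIncl y = !₂[y 0, y 1, 0] := rfl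

lemma horizontalProj_apply (x : E3) : horizontalProj x = !₂[x 0, x 1] := rfl

lemma height_apply (x : E3) : height x = x 2 := rfl

lemma norm_horizontalProj_le : ‖horizontalProj‖ ≤ 1 := by
  refine ContinuousLinearMap.opNorm_le_bound _ zero_le_one fun x => ?_
  rw [one_mul]
  refine abs_le_of_sq_le_sq' ?_ (norm_nonneg _) |>.2
  rw [EuclideanSpace.norm_sq_eq, EuclideanSpace.norm_sq_eq, Fin.sum_univ_two, Fin.sum_univ_three]
  simp [horizontalProj_apply]
  positivity

lemma norm_height_le : ‖height‖ ≤ 1 :=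
  ContinuousLinearMap.opNorm_le_bound _ zero_le_one fun x => by
    simpa [height_apply] using PiLp.norm_apply_le x 2

lemma horizontalProj_comp_incl :
    horizontalProj ∘L horizontalIncl = ContinuousLinearMap.id ℝ E2 := by
  ext y i
  fin_cases i <;> simp [horizontalProj_apply, horizontalIncl_apply]

lemma height_comp_incl : height ∘L horizontalIncl = 0 := by
  ext y
  simp [height_apply, horizontalIncl_apply]

lemma stereo_symm_zero : stereo.symm (0 : E2) = southPole := by
  ext i
  fin_cases i <;> simp [stereo, southPole, northPole]

lemma fderiv_coe_stereo_symm_zero :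
    fderiv ℝ (fun y : E2 => (stereo.symm y : E3)) 0 = horizontalIncl := by
  have h0 : HasFDerivAt (fun y : E2 => y 0) (EuclideanSpace.proj 0 : E2 →L[ℝ] ℝ) 0 :=
    (EuclideanSpace.proj 0 : E2 →L[ℝ] ℝ).hasFDerivAt
  have h1 : HasFDerivAt (fun y : E2 => y 1) (EuclideanSpace.proj 1 : E2 →L[ℝ] ℝ) 0 :=
    (EuclideanSpace.proj 1 : E2 →L[ℝ] ℝ).hasFDerivAt
  -- $|y|^2$ has no first-order part, so to first order the denominators are constantly $4$ and
  -- cancel the factor $4$.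
  have hS : HasFDerivAt (fun y : E2 => y 0 ^ 2 + y 1 ^ 2) (0 : E2 →L[ℝ] ℝ) 0 := by
    convert! (h0.pow 2).add (h1.pow 2) using 1
    simp
  have hQ : HasFDerivAt (fun y : E2 => (y 0 ^ 2 + y 1 ^ 2 + 4)⁻¹) (0 : E2 →L[ℝ] ℝ) 0 := by
    convert! (hasDerivAt_inv (by simp)).comp_hasFDerivAt (0 : E2) (hS.add_const 4) using 1
    simp
  refine HasFDerivAt.fderiv ?_
  rw [← hasFDerivWithinAt_univ, hasFDerivWithinAt_euclidean]
  intro i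
  rw [hasFDerivWithinAt_univ]
  fin_cases i
  · convert! (h0.const_mul 4).mul hQ using 1
    ext v
    simp [horizontalIncl_apply]
  · convert! (h1.const_mul 4).mul hQ using 1
    ext v
    simp [horizontalIncl_apply]
  · convert! (hS.sub_const 4).mul hQ using 1
    ext v
    simp [horizontalIncl_apply]

/-- The map `f ∘ p⁻¹`, seen as a map from the plane to `ℝ³`. -/
def planeMap (f : S2 → S2) (y : E2) : E3 := f (stereo.symm y)

lemma contDiff_planeMap_of_plot {n : ℕ} {P : EuclideanSpace ℝ (Fin n) → Omega1}
    (hP : Diffeology.IsPlot P) :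
    ContDiff ℝ ∞ (Function.uncurry fun s : EuclideanSpace ℝ (Fin n) => planeMap (P s).1) := by
  have h : ContMDiffOn ((𝓡 n).prod (𝓡 2)) (𝓡 2) ∞
      (fun q : EuclideanSpace ℝ (Fin n) × S2 => (P q.1).1 q.2) (Set.univ ×ˢ Set.univ) := hP
  rw [Set.univ_prod_univ, contMDiffOn_univ] at h
  have hr : ContMDiff 𝓘(ℝ, EuclideanSpace ℝ (Fin n) × E2) ((𝓡 n).prod (𝓡 2)) ∞
      (fun q : EuclideanSpace ℝ (Fin n) × E2 => (q.1, stereo.symm q.2)) :=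
    contDiff_fst.contMDiff.prodMk (contMDiff_stereo_symm.comp contDiff_snd.contMDiff)
  exact (contMDiff_coe_S2.comp (h.comp hr)).contDiff

lemma contDiff_planeMap (f : DiffS2) : ContDiff ℝ ∞ (planeMap f) :=
  (contMDiff_coe_S2.comp (f.contMDiff.comp contMDiff_stereo_symm)).contDiff

lemma planeMap_zero {f : DiffS2} (hf : f ∈ Omega1) : planeMap f 0 = !₂[0, 0, -1] := by
  rw [planeMap, stereo_symm_zero, hf.2.1]
  ext i
  fin_cases i <;> simp [southPole, northPole]

/-- By the chain rule and $df|_{x_0}=\mathrm{id}$, $F$ and $p^{-1}$ have the same derivative at $0$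
as maps into $\mathbb{R}^3$. -/
lemma fderiv_planeMap_zero {f : DiffS2} (hf : f ∈ Omega1) :
    fderiv ℝ (planeMap f) 0 = horizontalIncl := by
  have hcoe : ∀ x : S2, MDifferentiableAt (𝓡 2) 𝓘(ℝ, E3) (fun z : S2 => (z : E3)) x :=
    fun x => (contMDiff_coe_S2 (m := 1)).mdifferentiable one_ne_zero x
  have hp : MDifferentiableAt 𝓘(ℝ, E2) (𝓡 2) (fun y : E2 => stereo.symm y) 0 :=
    contMDiff_stereo_symm.mdifferentiable (by simp) 0
  have hfd : ∀ x, MDifferentiableAt (𝓡 2) (𝓡 2) f x := f.contMDiff.mdifferentiable (by simp)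
  have hd := hf.2.2
  rw [← stereo_symm_zero] at hd
  rw [← fderiv_coe_stereo_symm_zero, ← mfderiv_eq_fderiv, ← mfderiv_eq_fderiv]
  have h1 : mfderiv 𝓘(ℝ, E2) 𝓘(ℝ, E3) (planeMap f) 0 =
      (mfderiv (𝓡 2) 𝓘(ℝ, E3) (fun z : S2 => (z : E3)) (f (stereo.symm 0))).comp
        ((mfderiv (𝓡 2) (𝓡 2) f (stereo.symm 0)).comp
          (mfderiv 𝓘(ℝ, E2) (𝓡 2) (fun y : E2 => stereo.symm y) 0)) := by
    rw [← mfderiv_comp (0 : E2) (hfd _) hp]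
    exact mfderiv_comp (0 : E2) (hcoe _) ((hfd _).comp (0 : E2) hp)
  have h2 : mfderiv 𝓘(ℝ, E2) 𝓘(ℝ, E3) (fun y : E2 => (stereo.symm y : E3)) 0 =
      (mfderiv (𝓡 2) 𝓘(ℝ, E3) (fun z : S2 => (z : E3)) (stereo.symm 0)).comp
          (mfderiv 𝓘(ℝ, E2) (𝓡 2) (fun y : E2 => stereo.symm y) 0) :=
    mfderiv_comp (0 : E2) (hcoe _) hp
  rw [h1, h2]
  ext1 v
  exact hd _

end Stereographic

/-! ### Taylor estimates near the origin. -/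

section Estimate

variable {F : E2 → E3} {M : ℝ}

lemma norm_fderiv_sub_horizontalIncl_le (hF : ContDiff ℝ ∞ F)
    (hM : ∀ y, ‖y‖ ≤ 1 → ‖fderiv ℝ (fderiv ℝ F) y‖ ≤ M) (hF' : fderiv ℝ F 0 = horizontalIncl)
    {y : E2} (hy : ‖y‖ ≤ 1) : ‖fderiv ℝ F y - horizontalIncl‖ ≤ M * ‖y‖ := by
  have hd : Differentiable ℝ (fderiv ℝ F) :=
    (hF.fderiv_right (m := 1) (by norm_cast)).differentiable one_ne_zero
  have := (convex_closedBall (0 : E2) 1).norm_image_sub_le_of_norm_fderiv_le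
    (f := fderiv ℝ F) (fun x _ => hd x) (fun x hx => hM x (by simpa using hx))
    (Metric.mem_closedBall_self zero_le_one) (y := y) (by simpa using hy)
  simpa [hF'] using this

/-- Mean value inequality on the ball of radius $\|y\|$, where the previous bound gives
$\|dF-dF_0\|\le M\|y\|$. -/
lemma norm_sub_sub_horizontalIncl_le (hF : ContDiff ℝ ∞ F)
    (hM : ∀ y, ‖y‖ ≤ 1 → ‖fderiv ℝ (fderiv ℝ F) y‖ ≤ M) (hF' : fderiv ℝ F 0 = horizontalIncl)
    {y : E2} (hy : ‖y‖ ≤ 1) : ‖F y - F 0 - horizontalIncl y‖ ≤ M * ‖y‖ ^ 2 := by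
  have hM0 : 0 ≤ M := (norm_nonneg (fderiv ℝ (fderiv ℝ F) 0)).trans (hM 0 (by simp))
  have hd : Differentiable ℝ F := hF.differentiable (by simp)
  have := (convex_closedBall (0 : E2) ‖y‖).norm_image_sub_le_of_norm_fderiv_le'
    (f := F) (φ := horizontalIncl) (C := M * ‖y‖) (fun x _ => hd x) (fun x hx => by
      have hx' : ‖x‖ ≤ ‖y‖ := by simpa using hx
      exact (norm_fderiv_sub_horizontalIncl_le hF hM hF' (hx'.trans hy)).trans
        (mul_le_mul_of_nonneg_left hx' hM0))
    (Metric.mem_closedBall_self (norm_nonneg y)) (y := y) (by simp)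
  rw [sub_zero] at this
  linarith

lemma abs_height_add_one_le (hF : ContDiff ℝ ∞ F)
    (hM : ∀ y, ‖y‖ ≤ 1 → ‖fderiv ℝ (fderiv ℝ F) y‖ ≤ M) (hF' : fderiv ℝ F 0 = horizontalIncl)
    (hF0 : F 0 = !₂[0, 0, -1]) {y : E2} (hy : ‖y‖ ≤ 1) : |F y 2 + 1| ≤ M * ‖y‖ ^ 2 := by
  have h : height (F y - F 0 - horizontalIncl y) = F y 2 + 1 := by
    simp [height_apply, hF0, horizontalIncl_apply]
  rw [← h, ← Real.norm_eq_abs]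
  exact ((height.le_of_opNorm_le norm_height_le _).trans_eq (one_mul _)).trans
    (norm_sub_sub_horizontalIncl_le hF hM hF' hy)

lemma norm_horizontalProj_apply_le (hF : ContDiff ℝ ∞ F)
    (hM : ∀ y, ‖y‖ ≤ 1 → ‖fderiv ℝ (fderiv ℝ F) y‖ ≤ M) (hF' : fderiv ℝ F 0 = horizontalIncl)
    (hF0 : F 0 = !₂[0, 0, -1]) {y : E2} (hy : ‖y‖ ≤ 1) :
    ‖horizontalProj (F y)‖ ≤ ‖y‖ + M * ‖y‖ ^ 2 := by
  have h : horizontalProj (F y) = y + horizontalProj (F y - F 0 - horizontalIncl y) := by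
    ext i
    fin_cases i <;> simp [horizontalProj_apply, hF0, horizontalIncl_apply]
  rw [h]
  refine (norm_add_le _ _).trans (add_le_add le_rfl ?_)
  exact ((horizontalProj.le_of_opNorm_le norm_horizontalProj_le _).trans_eq (one_mul _)).trans
    (norm_sub_sub_horizontalIncl_le hF hM hF' hy)

/-- The formula of the stereographic projection, composed with `F`. -/
def stereoComp (F : E2 → E3) (y : E2) : E2 := (2 * (1 - F y 2)⁻¹) • horizontalProj (F y)

lemma hasFDerivAt_stereoComp {F' : E2 →L[ℝ] E3} {y : E2} (hF : HasFDerivAt F F' y)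
    (hy : 1 - F y 2 ≠ 0) :
    HasFDerivAt (stereoComp F)
      ((2 * (1 - F y 2)⁻¹) • (horizontalProj ∘L F') +
        ((2 * ((1 - F y 2) ^ 2)⁻¹) • (height ∘L F')).smulRight (horizontalProj (F y))) y := by
  have hh : HasFDerivAt (fun y => F y 2) (height ∘L F') y := height.hasFDerivAt.comp y hF
  have hc : HasFDerivAt (fun y => 2 * (1 - F y 2)⁻¹)
      ((2 * ((1 - F y 2) ^ 2)⁻¹) • (height ∘L F')) y := by
    convert! ((hasDerivAt_inv hy).comp_hasFDerivAt y (hh.const_sub 1)).const_mul 2 using 1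
    ext v
    simp
    ring
  exact hc.smul (horizontalProj.hasFDerivAt.comp y hF)

lemma norm_fderiv_stereoComp_sub_id_lt (hF : ContDiff ℝ ∞ F) (hM1 : 1 ≤ M)
    (hM : ∀ y, ‖y‖ ≤ 1 → ‖fderiv ℝ (fderiv ℝ F) y‖ ≤ M) (hF' : fderiv ℝ F 0 = horizontalIncl)
    (hF0 : F 0 = !₂[0, 0, -1]) {y : E2} (hy : M * ‖y‖ ≤ 1 / 20) :
    ‖fderiv ℝ (stereoComp F) y - ContinuousLinearMap.id ℝ E2‖ < 1 / 4 := by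
  have hy20 : ‖y‖ ≤ 1 / 20 := (le_mul_of_one_le_left (norm_nonneg y) hM1).trans hy
  have hy1 : ‖y‖ ≤ 1 := by linarith
  have hsq : M * ‖y‖ ^ 2 ≤ 1 / 400 := by nlinarith [norm_nonneg y]
  have hD := (norm_fderiv_sub_horizontalIncl_le hF hM hF' hy1).trans hy
  have hs := (abs_height_add_one_le hF hM hF' hF0 hy1).trans hsq
  have hu := norm_horizontalProj_apply_le hF hM hF' hF0 hy1
  set T := fderiv ℝ F y with hT
  set w := 1 - F y 2 with hw
  have hwb : 799 / 400 ≤ w ∧ w ≤ 801 / 400 := by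
    have := abs_le.1 hs
    constructor <;> linarith [this.1, this.2]
  have hw0 : w ≠ 0 := by linarith [hwb.1]
  have hπ : ‖horizontalProj ∘L T - ContinuousLinearMap.id ℝ E2‖ ≤ 1 / 20 := by
    rw [← horizontalProj_comp_incl, ← ContinuousLinearMap.comp_sub]
    exact (ContinuousLinearMap.opNorm_comp_le _ _).trans
      ((mul_le_of_le_one_left (norm_nonneg _) norm_horizontalProj_le).trans hD)
  have hh : ‖height ∘L T‖ ≤ 1 / 20 := by
    rw [← sub_zero (height ∘L T), ← height_comp_incl, ← ContinuousLinearMap.comp_sub]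
    exact (ContinuousLinearMap.opNorm_comp_le _ _).trans
      ((mul_le_of_le_one_left (norm_nonneg _) norm_height_le).trans hD)
  have hc : |2 * w⁻¹ - 1| ≤ 1 / 20 := by
    rw [abs_le, ← div_eq_mul_inv]
    have hwpos : 0 < w := by linarith [hwb.1]
    constructor
    · have : 19 / 20 ≤ 2 / w := by rw [le_div_iff₀ hwpos]; linarith [hwb.2]
      linarith
    · have : 2 / w ≤ 21 / 20 := by rw [div_le_iff₀ hwpos]; linarith [hwb.1]
      linarith
  have hc2 : |2 * (w ^ 2)⁻¹| ≤ 1 := by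
    rw [abs_of_nonneg (by positivity), ← div_eq_mul_inv, div_le_one (by positivity)]
    nlinarith [hwb.1]
  rw [(hasFDerivAt_stereoComp (hF.differentiable (by simp) y).hasFDerivAt hw0).fderiv]
  -- Three errors: $dF$ off the inclusion, the scaling factor $2/w$ off $1$, and the variation of
  -- that factor. They contribute at most $2/20$, $1/20$ and $1/20$, in total $1/5<1/4$.
  have hdec : (2 * w⁻¹) • (horizontalProj ∘L T) +
        ((2 * (w ^ 2)⁻¹) • (height ∘L T)).smulRight (horizontalProj (F y))
        - ContinuousLinearMap.id ℝ E2 =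
      (2 * w⁻¹) • (horizontalProj ∘L T - ContinuousLinearMap.id ℝ E2) +
        (2 * w⁻¹ - 1) • ContinuousLinearMap.id ℝ E2 +
        ((2 * (w ^ 2)⁻¹) • (height ∘L T)).smulRight (horizontalProj (F y)) := by
    module
  rw [hdec]
  have hid : ‖ContinuousLinearMap.id ℝ E2‖ ≤ 1 := ContinuousLinearMap.norm_id_le
  have hc' : |2 * w⁻¹| ≤ 2 := by
    rw [abs_le] at hc ⊢
    constructor <;> linarith [hc.1, hc.2]
  have n1 : ‖(2 * w⁻¹) • (horizontalProj ∘L T - ContinuousLinearMap.id ℝ E2)‖ ≤ 2 * (1 / 20) := by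
    rw [norm_smul, Real.norm_eq_abs]
    gcongr
  have n2 : ‖(2 * w⁻¹ - 1) • ContinuousLinearMap.id ℝ E2‖ ≤ 1 / 20 * 1 := by
    rw [norm_smul, Real.norm_eq_abs]
    gcongr
  have n3 : ‖((2 * (w ^ 2)⁻¹) • (height ∘L T)).smulRight (horizontalProj (F y))‖
      ≤ (1 * (1 / 20)) * 1 := by
    rw [ContinuousLinearMap.norm_smulRight_apply, norm_smul, Real.norm_eq_abs]
    gcongr
    linarith
  exact (norm_add₃_le.trans (add_le_add_three n1 n2 n3)).trans_lt (by norm_num)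

end Estimate

/-- No domain restriction is needed: where the denominator vanishes, both sides are $0$ by the
convention for division by zero. -/
lemma localExpr_eq_stereoComp (f : DiffS2) : localExpr f = stereoComp (planeMap f) := by
  ext y i
  fin_cases i <;> simp [localExpr, stereoComp, stereo, planeMap, horizontalProj_apply] <;> ring

/-- A radius, depending smoothly on `f ∈ Ω₁`, on which the local expression of `f` is close to the
identity. -/
theorem exists_dSmooth_radius :
    ∃ ε : Omega1 → ℝ,
      Diffeology.DSmooth ε ∧
      (∀ f, ε f ∈ Set.Ioc (0 : ℝ) (1 / 2)) ∧
      (∀ f, Metric.ball (0 : E2) (2 * ε f) ⊆ localExprDomain f.1) ∧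
      ∀ f, ∀ y ∈ Metric.ball (0 : E2) (ε f),
        ‖fderiv ℝ (localExpr f.1) y - ContinuousLinearMap.id ℝ E2‖ < 1 / 4 := by
  obtain ⟨q, hq, hq1, hqn⟩ := exists_contDiff_norm_le (E2 →L[ℝ] E2 →L[ℝ] E3)
  let g : (E2 → E3) → E2 → ℝ := fun F y => q (fderiv ℝ (fderiv ℝ F) y)
  let M : Omega1 → ℝ := fun f => supBound₂ (g (planeMap f.1))
  have hgM : ∀ (f : Omega1) (y : E2), ‖y‖ ≤ 1 → g (planeMap f.1) y ≤ M f := fun f y hy =>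
    le_supBound₂ (hq.comp (((contDiff_planeMap f.1).fderiv_right (m := ∞) (by simp)).fderiv_right
      (m := ∞) (by simp))) hy
  have hM1 : ∀ f, 1 ≤ M f := fun f => (hq1 _).trans (hgM f 0 (by simp))
  have hM : ∀ (f : Omega1) (y : E2), ‖y‖ ≤ 1 → ‖fderiv ℝ (fderiv ℝ (planeMap f.1)) y‖ ≤ M f :=
    fun f y hy => (hqn _).trans (hgM f y hy)
  have hpos : ∀ f, 0 < M f := fun f => one_pos.trans_le (hM1 f)
  have hmul : ∀ f : Omega1, M f * (1 / (20 * M f)) = 1 / 20 := fun f => by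
    have := (hpos f).ne'
    field_simp
  -- This gives $M\|y\|\le 1/20$ on $B(\varepsilon)$ and $M\|y\|\le 1/10$ on $B(2\varepsilon)$.
  refine ⟨fun f => 1 / (20 * M f), fun n P hP => ?_, fun f => ⟨?_, ?_⟩, fun f y hy => ?_,
    fun f y hy => ?_⟩
  · refine Diffeology.isPlot_iff_contDiff.2 ?_
    have h := contDiff_planeMap_of_plot hP
    have h1 : ContDiff ℝ ∞ (Function.uncurry fun s => fderiv ℝ (planeMap (P s).1)) :=
      ContDiff.fderiv (m := ∞) (f := fun p : EuclideanSpace ℝ (Fin n) × E2 => planeMap (P p.1).1)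
        (h.comp ((contDiff_fst.comp contDiff_fst).prodMk contDiff_snd)) contDiff_snd (by simp)
    have h2 : ContDiff ℝ ∞ (Function.uncurry fun s => fderiv ℝ (fderiv ℝ (planeMap (P s).1))) :=
      ContDiff.fderiv (m := ∞)
        (f := fun p : EuclideanSpace ℝ (Fin n) × E2 => fderiv ℝ (planeMap (P p.1).1))
        (h1.comp ((contDiff_fst.comp contDiff_fst).prodMk contDiff_snd)) contDiff_snd (by simp)
    have h3 : ContDiff ℝ ∞ fun s => M (P s) :=
      contDiff_supBound₂ (g := fun s => g (planeMap (P s).1)) (hq.comp h2)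
    exact contDiff_const.div (contDiff_const.mul h3)
      fun s => mul_ne_zero (by norm_num) (hpos (P s)).ne'
  · have := hpos f
    positivity
  · have := hM1 f
    exact one_div_le_one_div_of_le (by norm_num) (by linarith)
  · have hy' : M f * ‖y‖ ≤ 1 / 10 := by
      have := mul_le_mul_of_nonneg_left (mem_ball_zero_iff.1 hy).le (hpos f).le
      linarith [hmul f]
    have hy1 : ‖y‖ ≤ 1 / 10 := (le_mul_of_one_le_left (norm_nonneg y) (hM1 f)).trans hy'
    have hh := abs_height_add_one_le (contDiff_planeMap f.1) (hM f) (fderiv_planeMap_zero f.2)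
      (planeMap_zero f.2) (hy1.trans (by norm_num))
    have hsq : M f * ‖y‖ ^ 2 ≤ 1 / 100 := by nlinarith [norm_nonneg y]
    -- At the North Pole the height is $1$, at distance $2$ from $-1$, whereas here that distance is
    -- at most $1/100$.
    intro hN
    have hN2 : planeMap f.1 y 2 = 1 := by
      have hN' : f.1 (stereo.symm y) = northPole := hN
      simp [planeMap, hN', northPole]
    rw [hN2] at hh
    norm_num at hh
    linarith
  · rw [localExpr_eq_stereoComp]
    refine norm_fderiv_stereoComp_sub_id_lt (contDiff_planeMap f.1) (hM1 f) (hM f)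
      (fderiv_planeMap_zero f.2) (planeMap_zero f.2) ?_
    rw [← hmul f]
    exact mul_le_mul_of_nonneg_left (mem_ball_zero_iff.1 hy).le (hpos f).le

end SphereDiff

end

theorem mainTheorem7 :
    ∃ ε : SphereDiff.Omega1 → ℝ,
      Diffeology.DSmooth ε ∧
      (∀ f, ε f ∈ Set.Ioc (0 : ℝ) (1 / 2)) ∧
      (∀ f, Metric.ball (0 : SphereDiff.E2) (2 * ε f) ⊆ SphereDiff.localExprDomain f.1) ∧
      ∀ f, ∀ y ∈ Metric.ball (0 : SphereDiff.E2) (ε f),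
        ‖fderiv ℝ (SphereDiff.localExpr f.1) y - ContinuousLinearMap.id ℝ SphereDiff.E2‖ < 1 / 4 := by
  exact SphereDiff.exists_dSmooth_radius
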